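/- **Theorem 6 (Fourman–Hyland).** Work in the topological model over $\mathbb C$, that is, in the Heyting-valued universe of sets over the frame of open subsets of $\mathbb C$; an open set $U$ forces a statement $\varphi$, written $U\Vdash\varphi$, if $U$ is contained in the truth value of $\varphi$. Complex numbers of the model are pairs of (two-sided Dedekind) real numbers of the model, and polynomials of the model are finite sequences of such complex numbers (the coefficients). Here "every polynomial has a root" means: every monic polynomial of positive degree with complex coefficients has a complex root. Let $G$ be the generic complex number of the model, whose real part has the truth value of $q<\operatorname{Re}G$ (for $q\in\mathbb Q$) equal to $\{w\in\mathbb C : q<\operatorname{Re}w\}$, that of $\operatorname{Re}G<q$ equal to $\{w\in\mathbb C : \operatorname{Re}w<q\}$, and similarly for the imaginary part. Then: 1. $\mathbb C\Vdash$ "not every polynomial has a root". 2. No non-empty open set forces "every polynomial has a root". 3. $\mathbb C\Vdash$ "$G$ is a complex number", and $O\Vdash G\in O$ for every open $O\subseteq\mathbb C$, where in the model $O$ is interpreted as the union of the open rectangles with rational vertices that are contained in $O$. 4. $X^2-G$ is forced by $\mathbb C$ to be a monic polynomial of degree $2$, and no open neighbourhood of $0$ forces "$X^2-G$ has a root". 5.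 More generally, for every $v\in\mathbb C$, $X^2-(G-v)$ is forced by $\mathbb C$ to be a monic polynomial of degree $2$, and no open neighbourhood of $v$ forces "$X^2-(G-v)$ has a root". -/

import Mathlib

open TopologicalSpace

noncomputable section

namespace TopModel

/-! ### The Heyting-valued universe of sets over a frame `H`

For `H = Opens T` this is the (full) topological model over the space `T`.  Formulas of set theory
are evaluated in `H` in the usual way: conjunction is `⊓`, disjunction is `⊔`, implication is `⇨`,
negation is `ᶜ`, the quantifiers `∀`, `∃` over all sets are `⨅`, `⨆` over all names, and a
quantifier bounded by a ground-model set is `⨅` or `⨆` over the elements of that set. -/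

/-- A name (term): a family of pairs `⟨p i, σ i⟩` of a truth value and a name. -/
inductive Name (H : Type) : Type 1
  | mk (ι : Type) (σ : ι → Name H) (p : ι → H) : Name H

variable {H : Type} [Order.Frame H]

/-- The truth value of `a = b` (extensional equality). -/
def eq : Name H → Name H → H
  | Name.mk ι σ p, Name.mk κ τ q =>
    (⨅ i : ι, p i ⇨ ⨆ j : κ, q j ⊓ eq (σ i) (τ j)) ⊓
    (⨅ j : κ, q j ⇨ ⨆ i : ι, p i ⊓ eq (σ i) (τ j))

/-- The truth value of `a ∈ b`. -/
def mem (a : Name H) : Name H → H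
  | Name.mk κ τ q => ⨆ j : κ, q j ⊓ eq a (τ j)

/-- The truth value of `a ⊆ b`. -/
def sub (a b : Name H) : H := ⨅ x : Name H, mem x a ⇨ mem x b

/-- The embedding of the ground model into the names. -/
def hat : PSet.{0} → Name H
  | PSet.mk ι A => Name.mk ι (fun i => hat (A i)) (fun _ => ⊤)

/-- The unordered pair `{a, b}`. -/
def upair (a b : Name H) : Name H := Name.mk Bool (fun i => cond i a b) (fun _ => ⊤)

/-- The Kuratowski ordered pair `(a, b) = {{a}, {a, b}}`. -/
def opair (a b : Name H) : Name H := upair (upair a a) (upair a b)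

/-- The natural number `n` (a von Neumann numeral) in the model. -/
def nat (n : ℕ) : Name H := hat (PSet.ofNat n)

/-- The rational number `q` in the model.  Rationals are represented as sets through an injective
coding by natural numbers. -/
def rat (q : ℚ) : Name H := nat (Encodable.encode q)

/-- The set `{q ∈ ℚ | φ q}` in the model. -/
def sepRat (φ : ℚ → H) : Name H := Name.mk ℚ rat φ

/-- The set of rational numbers of the model. -/
def ratSet : Name H := sepRat fun _ => ⊤

/-! ### Real and complex numbers of the model -/

/-- `(L, U)` is a (two-sided) Dedekind cut in the rationals: `L` and `U` are sets of rationals,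
inhabited, rounded, disjoint and located. -/
def IsCut (L U : Name H) : H :=
  sub L ratSet ⊓ sub U ratSet ⊓
  (⨆ q : ℚ, mem (rat q) L) ⊓ (⨆ q : ℚ, mem (rat q) U) ⊓
  (⨅ q : ℚ, bihimp (mem (rat q) L) (⨆ r : ℚ, ⨆ _ : q < r, mem (rat r) L)) ⊓
  (⨅ q : ℚ, bihimp (mem (rat q) U) (⨆ r : ℚ, ⨆ _ : r < q, mem (rat r) U)) ⊓
  (⨅ q : ℚ, (mem (rat q) L ⊓ mem (rat q) U)ᶜ) ⊓
  (⨅ q : ℚ, ⨅ r : ℚ, ⨅ _ : q < r, mem (rat q) L ⊔ mem (rat r) U)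

/-- `x` is a real number: an ordered pair forming a Dedekind cut. -/
def IsReal (x : Name H) : H := ⨆ L : Name H, ⨆ U : Name H, eq x (opair L U) ⊓ IsCut L U

/-- `z` is a complex number: an ordered pair of real numbers. -/
def IsComplex (z : Name H) : H :=
  ⨆ x : Name H, ⨆ y : Name H, eq z (opair x y) ⊓ IsReal x ⊓ IsReal y

/-- The truth value of `q < x`, for `x` a real number. -/
def lo (x : Name H) (q : ℚ) : H := ⨆ L : Name H, ⨆ U : Name H, eq x (opair L U) ⊓ mem (rat q) L

/-- The truth value of `x < q`, for `x` a real number. -/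
def up (x : Name H) (q : ℚ) : H := ⨆ L : Name H, ⨆ U : Name H, eq x (opair L U) ⊓ mem (rat q) U

/-- The pair of sets of rationals `({q | φ q}, {q | ψ q})`. -/
def cut (φ ψ : ℚ → H) : Name H := opair (sepRat φ) (sepRat ψ)

/-- The sum of real numbers. -/
def addR (x y : Name H) : Name H :=
  cut (fun q => ⨆ r : ℚ, lo x r ⊓ lo y (q - r)) (fun q => ⨆ r : ℚ, up x r ⊓ up y (q - r))

/-- The negative of a real number. -/
def negR (x : Name H) : Name H := cut (fun q => up x (-q)) (fun q => lo x (-q))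

/-- The product of real numbers: `q < x * y` if `q < s * t` for all `s`, `t` in some rational
intervals around `x` and `y`, and similarly for `x * y < q`. -/
def mulR (x y : Name H) : Name H :=
  cut
    (fun q => ⨆ a : ℚ, ⨆ b : ℚ, ⨆ c : ℚ, ⨆ d : ℚ,
      ⨆ _ : q < min (min (a * c) (a * d)) (min (b * c) (b * d)),
        lo x a ⊓ up x b ⊓ lo y c ⊓ up y d)
    (fun q => ⨆ a : ℚ, ⨆ b : ℚ, ⨆ c : ℚ, ⨆ d : ℚ,
      ⨆ _ : max (max (a * c) (a * d)) (max (b * c) (b * d)) < q,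
        lo x a ⊓ up x b ⊓ lo y c ⊓ up y d)

/-- The real number of the model given by a real number of the ground model. -/
def constR (r : ℝ) : Name H :=
  cut (fun q => ⨆ _ : (q : ℝ) < r, ⊤) (fun q => ⨆ _ : r < (q : ℝ), ⊤)

/-- The real part of a complex number. -/
def re (z : Name H) : Name H :=
  cut (fun q => ⨆ x : Name H, ⨆ y : Name H, eq z (opair x y) ⊓ lo x q)
    (fun q => ⨆ x : Name H, ⨆ y : Name H, eq z (opair x y) ⊓ up x q)

/-- The imaginary part of a complex number. -/
def im (z : Name H) : Name H :=
  cut (fun q => ⨆ x : Name H, ⨆ y : Name H, eq z (opair x y) ⊓ lo y q)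
    (fun q => ⨆ x : Name H, ⨆ y : Name H, eq z (opair x y) ⊓ up y q)

/-- The sum of complex numbers. -/
def addC (z w : Name H) : Name H := opair (addR (re z) (re w)) (addR (im z) (im w))

/-- The negative of a complex number. -/
def negC (z : Name H) : Name H := opair (negR (re z)) (negR (im z))

/-- The product of complex numbers. -/
def mulC (z w : Name H) : Name H :=
  opair (addR (mulR (re z) (re w)) (negR (mulR (im z) (im w))))
    (addR (mulR (re z) (im w)) (mulR (im z) (re w)))

/-- The complex number of the model given by a complex number of the ground model. -/
def constC (c : ℂ) : Name H := opair (constR c.re) (constR c.im)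

/-- The power `z ^ k` of a complex number. -/
def powC (z : Name H) : ℕ → Name H
  | 0 => constC 1
  | k + 1 => mulC (powC z k) z

/-- The sum `∑ k < m, a k * z ^ k`. -/
def sumC (a : ℕ → Name H) (z : Name H) : ℕ → Name H
  | 0 => constC 0
  | m + 1 => addC (sumC a z m) (mulC (a m) (powC z m))

/-! ### Polynomials of the model

A polynomial of formal degree `n` is its sequence of coefficients, a function from
`{0, …, n}` to the complex numbers. -/

/-- `p` is a function from `{0, …, n}` to the set of complex numbers. -/
def IsPoly (n : ℕ) (p : Name H) : H :=
  (⨅ x : Name H, mem x p ⇨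
    ⨆ k : Fin (n + 1), ⨆ c : Name H, IsComplex c ⊓ eq x (opair (nat k) c)) ⊓
  (⨅ k : Fin (n + 1), ⨆ c : Name H, mem (opair (nat k) c) p) ⊓
  (⨅ k : Fin (n + 1), ⨅ c : Name H, ⨅ d : Name H,
    mem (opair (nat k) c) p ⊓ mem (opair (nat k) d) p ⇨ eq c d)

/-- `p` is a monic polynomial of degree `n`. -/
def IsMonicPoly (n : ℕ) (p : Name H) : H := IsPoly n p ⊓ mem (opair (nat n) (constC 1)) p

/-- `z` is a root of `p`: if `a 0, …, a n` are the coefficients of `p`, then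
`∑ k ≤ n, a k * z ^ k = 0`. -/
def IsRoot (n : ℕ) (p z : Name H) : H :=
  ⨆ a : ℕ → Name H, (⨅ k : Fin (n + 1), mem (opair (nat k) (a k)) p) ⊓
    eq (sumC a z (n + 1)) (constC 0)

/-- `p` (of formal degree `n`) has a root in the complex numbers. -/
def HasRoot (n : ℕ) (p : Name H) : H := ⨆ z : Name H, IsComplex z ⊓ IsRoot n p z

/-- The truth value of: every monic polynomial of positive degree over the complex numbers has
a root in the complex numbers. -/
def EveryPolyHasRoot (H : Type) [Order.Frame H] : H :=
  ⨅ n : ℕ, ⨅ _ : 1 ≤ n, ⨅ p : Name H, IsMonicPoly n p ⇨ HasRoot n p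

/-- The polynomial `X ^ 2 - c`, with coefficients `-c`, `0`, `1`. -/
def sqSub (c : Name H) : Name H :=
  Name.mk (Fin 3) (fun k => opair (nat k) (![negC c, constC 0, constC 1] k)) (fun _ => ⊤)

/-! ### Forcing, and the generic complex number -/

/-- The open set `U` forces a formula with truth value `φ`. -/
def Forces {T : Type} [TopologicalSpace T] (U φ : Opens T) : Prop := U ≤ φ

infix:45 " ⊩ " => Forces

/-- The open set of all `w` with `f w < g w`. -/
def openLt (f g : ℂ → ℝ) (hf : Continuous f) (hg : Continuous g) : Opens ℂ :=
  ⟨{w | f w < g w}, isOpen_lt hf hg⟩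

/-- The generic complex number `G` of the topological model over `ℂ`:
`q < Re G` has truth value `{w | q < Re w}`, and so on. -/
def generic : Name (Opens ℂ) :=
  opair
    (cut (fun q => openLt (fun _ => (q : ℝ)) Complex.re continuous_const Complex.continuous_re)
      (fun q => openLt Complex.re (fun _ => (q : ℝ)) Complex.continuous_re continuous_const))
    (cut (fun q => openLt (fun _ => (q : ℝ)) Complex.im continuous_const Complex.continuous_im)
      (fun q => openLt Complex.im (fun _ => (q : ℝ)) Complex.continuous_im continuous_const))

/-- The truth value of `z ∈ O`, for `z` a complex number of the model and `O` an open set of the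
ground model.  In the model, `O` is interpreted as the union of the open rectangles with rational
vertices that are contained in `O`. -/
def memOpen (z : Name H) (O : Opens ℂ) : H :=
  ⨆ a : ℚ, ⨆ b : ℚ, ⨆ c : ℚ, ⨆ d : ℚ,
    ⨆ _ : ∀ w : ℂ, a < w.re → w.re < b → c < w.im → w.im < d → w ∈ O,
      lo (re z) a ⊓ up (re z) b ⊓ lo (im z) c ⊓ up (im z) d

end TopModel

end

open TopModel

/-! A complex number of the model near a point is a continuous complex function there. At each point
`w` the true instances of the cut axioms describe an ordinary Dedekind cut, hence a number
(`exists_isValue`), and since truth values are open this number varies continuously with `w`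
(`continuousOn_of_isComplexValue`). Arithmetic in the model is pointwise arithmetic of values, and
`generic` is the identity function.

A root of `X ^ 2 - (G - v)` near `v` would thus be a continuous `f` with `f w ^ 2 = w - v` on a
neighbourhood of `v` (`sq_eq_of_mem_isRoot_sqSub`). Monodromy around `v` excludes this
(`not_exists_continuousOn_sq_eq_sub`). Any non-empty open set contains some `v`, so the truth value
of the algebraic closure statement is empty and its negation holds everywhere. -/

namespace TopModel

/-! ### Equality and substitution in the Heyting-valued universe -/

section Frame

variable {H : Type} [Order.Frame H]

theorem eq_refl (a : Name H) : eq a a = ⊤ := by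
  induction a with
  | mk ι σ p ih =>
    rw [eq, inf_eq_top_iff]
    exact ⟨iInf_eq_top.2 fun i => himp_eq_top_iff.2 (le_trans (by simp [ih i])
        (le_iSup (fun j => p j ⊓ eq (σ i) (σ j)) i)),
      iInf_eq_top.2 fun i => himp_eq_top_iff.2 (le_trans (by simp [ih i])
        (le_iSup (fun j => p j ⊓ eq (σ j) (σ i)) i))⟩

theorem eq_comm' (a b : Name H) : eq a b = eq b a := by
  induction a generalizing b with
  | mk ι σ p ih =>
    cases b with
    | mk κ τ q =>
      rw [eq, eq, inf_comm]
      simp only [ih]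

theorem mem_mk (a : Name H) {κ : Type} (τ : κ → Name H) (q : κ → H) :
    mem a (Name.mk κ τ q) = ⨆ j : κ, q j ⊓ eq a (τ j) := by rw [mem]

theorem eq_mk_left {ι : Type} (σ : ι → Name H) (p : ι → H) (b : Name H) :
    eq (Name.mk ι σ p) b ≤ ⨅ i, p i ⇨ mem (σ i) b := by
  cases b
  rw [eq]
  exact inf_le_left.trans (by simp only [mem_mk, le_refl])

theorem eq_eq_inf {ι κ : Type} (σ : ι → Name H) (p : ι → H) (τ : κ → Name H) (q : κ → H) :
    eq (Name.mk ι σ p) (Name.mk κ τ q) =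
      (⨅ i, p i ⇨ mem (σ i) (Name.mk κ τ q)) ⊓ (⨅ j, q j ⇨ mem (τ j) (Name.mk ι σ p)) := by
  rw [eq]
  simp only [mem_mk, eq_comm' (τ _) (σ _)]

/-- Induction on the middle name: substituting equals into a membership needs transitivity only
through the elements `τ j` of `b`, and two such substitutions give the two inclusions between `a`
and `c`. -/
theorem eq_trans (a b c : Name H) : eq a b ⊓ eq b c ≤ eq a c := by
  induction b generalizing a c with
  | mk κ τ q ih =>
    have key : ∀ x d : Name H,
        mem x (Name.mk κ τ q) ⊓ eq (Name.mk κ τ q) d ≤ mem x d := by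
      intro x d
      cases d with
      | mk l υ r =>
        rw [mem_mk, iSup_inf_eq]
        refine iSup_le fun j => ?_
        have h1 : q j ⊓ eq (Name.mk κ τ q) (Name.mk l υ r) ≤ mem (τ j) (Name.mk l υ r) := by
          rw [inf_comm, ← le_himp_iff]
          exact (eq_mk_left _ _ _).trans (iInf_le _ j)
        have h2 : eq x (τ j) ⊓ mem (τ j) (Name.mk l υ r) ≤ mem x (Name.mk l υ r) := by
          rw [mem_mk, mem_mk, inf_iSup_eq]
          refine iSup_mono fun k => ?_
          rw [inf_left_comm]
          exact inf_le_inf_left _ (ih j _ _)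
        refine le_trans ?_ h2
        refine le_inf (inf_le_left.trans inf_le_right) (le_trans ?_ h1)
        exact inf_le_inf_right _ inf_le_left
    cases a with
    | mk ι σ p =>
      cases c with
      | mk l υ r =>
        rw [eq_eq_inf σ p υ r]
        refine le_inf (le_iInf fun i => ?_) (le_iInf fun k => ?_)
        · rw [le_himp_iff]
          refine le_trans ?_ (key _ _)
          refine le_inf ?_ (inf_le_left.trans inf_le_right)
          rw [← le_himp_iff]
          exact inf_le_left.trans ((eq_mk_left _ _ _).trans (iInf_le _ i))
        · rw [le_himp_iff]
          refine le_trans ?_ (key _ _)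
          rw [eq_comm' (Name.mk ι σ p)]
          refine le_inf ?_ (inf_le_left.trans inf_le_left)
          rw [← le_himp_iff]
          refine inf_le_right.trans ?_
          rw [eq_comm']
          exact (eq_mk_left _ _ _).trans (iInf_le _ k)

theorem mem_eq_left (a b c : Name H) : eq a b ⊓ mem b c ≤ mem a c := by
  cases c
  rw [mem_mk, mem_mk, inf_iSup_eq]
  refine iSup_mono fun k => ?_
  rw [inf_left_comm]
  exact inf_le_inf_left _ (eq_trans _ _ _)

theorem mem_eq_right (a b c : Name H) : mem a b ⊓ eq b c ≤ mem a c := by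
  cases b with
  | mk κ τ q =>
    rw [mem_mk, iSup_inf_eq]
    refine iSup_le fun j => ?_
    refine le_trans ?_ (mem_eq_left a (τ j) c)
    refine le_inf (inf_le_left.trans inf_le_right) ?_
    refine le_trans (inf_le_inf_right _ inf_le_left) ?_
    rw [inf_comm, ← le_himp_iff]
    exact (eq_mk_left _ _ _).trans (iInf_le _ j)

end Frame

/-! ### Truth at a point: pairs, numerals, rationals -/

section Points

variable {T : Type} [TopologicalSpace T] {w : T}

/-- Only this direction holds: an infimum of open sets is the interior of the intersection. -/
theorem mem_iInf_apply {ι : Sort*} {f : ι → Opens T} (h : w ∈ ⨅ i, f i) (i : ι) : w ∈ f i :=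
  iInf_le f i h

theorem mem_himp_apply {a b : Opens T} (h : w ∈ a ⇨ b) (ha : w ∈ a) : w ∈ b :=
  (himp_inf_le : (a ⇨ b) ⊓ a ≤ b) ⟨h, ha⟩

theorem mem_bihimp_iff {a b : Opens T} (h : w ∈ bihimp a b) : w ∈ a ↔ w ∈ b :=
  ⟨mem_himp_apply h.2, mem_himp_apply h.1⟩

theorem mem_eq_refl (a : Name (Opens T)) : w ∈ eq a a := by
  rw [eq_refl]
  trivial

theorem mem_eq_symm {a b : Name (Opens T)} (h : w ∈ eq a b) : w ∈ eq b a := by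
  rwa [eq_comm']

theorem mem_eq_trans {a b c : Name (Opens T)} (h : w ∈ eq a b) (h' : w ∈ eq b c) : w ∈ eq a c :=
  eq_trans a b c ⟨h, h'⟩

theorem mem_mem_congr {a a' b b' : Name (Opens T)} (h : w ∈ eq a a') (h' : w ∈ eq b b')
    (hm : w ∈ mem a b) : w ∈ mem a' b' :=
  mem_eq_right a' b b' ⟨mem_eq_left a' a b ⟨mem_eq_symm h, hm⟩, h'⟩

theorem mem_mem_mk {a : Name (Opens T)} {κ : Type} {τ : κ → Name (Opens T)} {q : κ → Opens T} :
    w ∈ mem a (Name.mk κ τ q) ↔ ∃ j, w ∈ q j ∧ w ∈ eq a (τ j) := by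
  rw [mem_mk, Opens.mem_iSup]
  rfl

/-- Suprema of open sets are unions, so disjunctions and existentials are decided pointwise. -/
theorem mem_mem_upair {x a b : Name (Opens T)} :
    w ∈ mem x (upair a b) ↔ w ∈ eq x a ∨ w ∈ eq x b := by
  rw [upair, mem_mem_mk, Bool.exists_bool]
  simp only [cond_true, cond_false, Opens.mem_top, true_and]
  exact or_comm

/-- The infima run over two indices and the premises are `⊤`, so no interior is lost and equality of
pairs is decided pointwise. -/
theorem mem_eq_upair {a b c d : Name (Opens T)} :
    w ∈ eq (upair a b) (upair c d) ↔
      ((w ∈ eq a c ∨ w ∈ eq a d) ∧ (w ∈ eq b c ∨ w ∈ eq b d)) ∧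
      ((w ∈ eq c a ∨ w ∈ eq c b) ∧ (w ∈ eq d a ∨ w ∈ eq d b)) := by
  have h : eq (upair a b) (upair c d) =
      (mem b (upair c d) ⊓ mem a (upair c d)) ⊓ (mem d (upair a b) ⊓ mem c (upair a b)) := by
    rw [upair, upair, eq_eq_inf]
    simp only [top_himp, iInf_bool_eq, cond_true, cond_false]
    simp only [inf_comm]
  rw [h]
  simp only [Opens.mem_inf, mem_mem_upair]
  tauto

theorem mem_eq_opair {a b c d : Name (Opens T)} :
    w ∈ eq (opair a b) (opair c d) ↔ w ∈ eq a c ∧ w ∈ eq b d := by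
  have tr : ∀ {x y z : Name (Opens T)}, w ∈ eq x y → w ∈ eq y z → w ∈ eq x z := mem_eq_trans
  have sy : ∀ {x y : Name (Opens T)}, w ∈ eq x y → w ∈ eq y x := mem_eq_symm
  rw [opair, opair]
  simp only [mem_eq_upair]
  constructor
  · intro h
    have hac : w ∈ eq a c := by
      rcases h.1.1 with h | h
      · exact h.1.1.elim id id
      · exact sy (h.2.1.elim id id)
    refine ⟨hac, ?_⟩
    have hb : w ∈ eq b c ∨ w ∈ eq b d := by
      rcases h.1.2 with h | h
      · exact Or.inl (h.1.2.elim id id)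
      · exact h.1.2
    have hd : w ∈ eq d a ∨ w ∈ eq d b := by
      rcases h.2.2 with h | h
      · exact Or.inl (h.1.2.elim id id)
      · exact h.1.2
    rcases hb with hb | hb
    · rcases hd with hd | hd
      · exact tr hb (tr (sy hac) (sy hd))
      · exact sy hd
    · exact hb
  · rintro ⟨h1, h2⟩
    have h1' := sy h1
    have h2' := sy h2
    tauto

/-- All weights in `hat` are `⊤`, so one point suffices to extract actual matching elements. -/
theorem equiv_of_mem_eq_hat {x y : PSet.{0}} (h : w ∈ eq (hat x : Name (Opens T)) (hat y)) : PSet.Equiv x y := by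
  induction x generalizing y with
  | mk ι A ih =>
    cases y with
    | mk κ B =>
      rw [hat, hat, eq_eq_inf] at h
      constructor
      · intro i
        obtain ⟨j, -, hj⟩ := mem_mem_mk.1 (mem_himp_apply (mem_iInf_apply h.1 i) trivial)
        exact ⟨j, ih i hj⟩
      · intro j
        obtain ⟨i, -, hi⟩ := mem_mem_mk.1 (mem_himp_apply (mem_iInf_apply h.2 j) trivial)
        exact ⟨i, ih i (mem_eq_symm hi)⟩

/-- Rank is invariant under equivalence of sets, so it separates the numerals. -/
theorem rank_ofNat (n : ℕ) : (PSet.ofNat.{0} n).rank = n := by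
  induction n with
  | zero => simp [PSet.ofNat]
  | succ n ih =>
    rw [PSet.ofNat, PSet.rank_insert, ih]
    simp

theorem mem_eq_nat {m n : ℕ} : w ∈ eq (nat m : Name (Opens T)) (nat n) ↔ m = n := by
  constructor
  · intro h
    have := PSet.rank_congr (equiv_of_mem_eq_hat h)
    rw [rank_ofNat, rank_ofNat] at this
    exact_mod_cast this
  · rintro rfl
    exact mem_eq_refl _

theorem mem_eq_rat {q r : ℚ} : w ∈ eq (rat q : Name (Opens T)) (rat r) ↔ q = r := by
  rw [rat, rat, mem_eq_nat, Encodable.encode_inj]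

theorem mem_rat_sepRat (q : ℚ) (φ : ℚ → Opens T) : mem (rat q) (sepRat φ) = φ q := by
  ext w
  change w ∈ mem (rat q) (sepRat φ) ↔ w ∈ φ q
  rw [sepRat, mem_mem_mk]
  constructor
  · rintro ⟨r, hr, h⟩
    rwa [mem_eq_rat.1 h]
  · exact fun h => ⟨q, h, mem_eq_refl _⟩

/-! ### Real and complex numbers evaluated at a point -/

theorem mem_lo {x : Name (Opens T)} {q : ℚ} :
    w ∈ lo x q ↔ ∃ L U, w ∈ eq x (opair L U) ∧ w ∈ mem (rat q) L := by
  simp only [lo, Opens.mem_iSup, Opens.mem_inf]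

theorem mem_up {x : Name (Opens T)} {q : ℚ} :
    w ∈ up x q ↔ ∃ L U, w ∈ eq x (opair L U) ∧ w ∈ mem (rat q) U := by
  simp only [up, Opens.mem_iSup, Opens.mem_inf]

theorem mem_lo_iff {x L U : Name (Opens T)} (h : w ∈ eq x (opair L U)) {q : ℚ} :
    w ∈ lo x q ↔ w ∈ mem (rat q) L := by
  rw [mem_lo]
  constructor
  · rintro ⟨L', U', h', hm⟩
    exact mem_mem_congr (mem_eq_refl _)
      (mem_eq_opair.1 (mem_eq_trans (mem_eq_symm h') h)).1 hm
  · exact fun hm => ⟨L, U, h, hm⟩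

theorem mem_up_iff {x L U : Name (Opens T)} (h : w ∈ eq x (opair L U)) {q : ℚ} :
    w ∈ up x q ↔ w ∈ mem (rat q) U := by
  rw [mem_up]
  constructor
  · rintro ⟨L', U', h', hm⟩
    exact mem_mem_congr (mem_eq_refl _)
      (mem_eq_opair.1 (mem_eq_trans (mem_eq_symm h') h)).2 hm
  · exact fun hm => ⟨L, U, h, hm⟩

theorem mem_lo_congr {x y : Name (Opens T)} (h : w ∈ eq x y) {q : ℚ} :
    w ∈ lo x q ↔ w ∈ lo y q := by
  rw [mem_lo, mem_lo]
  exact ⟨fun ⟨L, U, h', hm⟩ => ⟨L, U, mem_eq_trans (mem_eq_symm h) h', hm⟩,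
    fun ⟨L, U, h', hm⟩ => ⟨L, U, mem_eq_trans h h', hm⟩⟩

theorem mem_up_congr {x y : Name (Opens T)} (h : w ∈ eq x y) {q : ℚ} :
    w ∈ up x q ↔ w ∈ up y q := by
  rw [mem_up, mem_up]
  exact ⟨fun ⟨L, U, h', hm⟩ => ⟨L, U, mem_eq_trans (mem_eq_symm h) h', hm⟩,
    fun ⟨L, U, h', hm⟩ => ⟨L, U, mem_eq_trans h h', hm⟩⟩

theorem mem_lo_cut {φ ψ : ℚ → Opens T} {q : ℚ} : w ∈ lo (cut φ ψ) q ↔ w ∈ φ q := by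
  rw [mem_lo_iff (mem_eq_refl (cut φ ψ)), mem_rat_sepRat]

theorem mem_up_cut {φ ψ : ℚ → Opens T} {q : ℚ} : w ∈ up (cut φ ψ) q ↔ w ∈ ψ q := by
  rw [mem_up_iff (mem_eq_refl (cut φ ψ)), mem_rat_sepRat]

/-- The real number `x` of the model takes the value `r` at the point `w`. -/
def IsValue (w : T) (x : Name (Opens T)) (r : ℝ) : Prop :=
  ∀ q : ℚ, (w ∈ lo x q ↔ (q : ℝ) < r) ∧ (w ∈ up x q ↔ r < (q : ℝ))

/-- The complex number `z` of the model takes the value `c` at the point `w`. -/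
def IsComplexValue (w : T) (z : Name (Opens T)) (c : ℂ) : Prop :=
  IsValue w (re z) c.re ∧ IsValue w (im z) c.im

theorem isValue_cut {φ ψ : ℚ → Opens T} {r : ℝ} :
    IsValue w (cut φ ψ) r ↔
      ∀ q : ℚ, (w ∈ φ q ↔ (q : ℝ) < r) ∧ (w ∈ ψ q ↔ r < (q : ℝ)) := by
  simp only [IsValue, mem_lo_cut, mem_up_cut]

theorem IsValue.congr {x y : Name (Opens T)} {r : ℝ} (h : w ∈ eq x y) (hx : IsValue w x r) :
    IsValue w y r := fun q => by
  rw [← mem_lo_congr h, ← mem_up_congr h]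
  exact hx q

theorem IsValue.unique {x : Name (Opens T)} {r s : ℝ} (hr : IsValue w x r) (hs : IsValue w x s) :
    r = s := by
  refine le_antisymm (le_of_forall_rat_lt_imp_le fun q hq => ?_)
    (le_of_forall_rat_lt_imp_le fun q hq => ?_)
  · exact ((hs q).1.1 ((hr q).1.2 hq)).le
  · exact ((hr q).1.1 ((hs q).1.2 hq)).le

theorem exists_isValue {x : Name (Opens T)} (h : w ∈ IsReal x) : ∃ r, IsValue w x r := by
  simp only [IsReal, Opens.mem_iSup, Opens.mem_inf] at h
  obtain ⟨L, U, hx, hc⟩ := h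
  simp only [IsCut, Opens.mem_inf, and_assoc] at hc
  obtain ⟨-, -, hL, hU, hrL, hrU, hd, hl⟩ := hc
  have rL : ∀ q : ℚ, w ∈ mem (rat q) L ↔ ∃ r, q < r ∧ w ∈ mem (rat r) L := fun q => by
    rw [mem_bihimp_iff (mem_iInf_apply hrL q)]
    simp only [Opens.mem_iSup, exists_prop]
  have rU : ∀ q : ℚ, w ∈ mem (rat q) U ↔ ∃ r, r < q ∧ w ∈ mem (rat r) U := fun q => by
    rw [mem_bihimp_iff (mem_iInf_apply hrU q)]
    simp only [Opens.mem_iSup, exists_prop]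
  -- The negation of a truth value is disjoint from it, so disjointness of the cut may be read at
  -- `w`.
  have disj : ∀ q : ℚ, w ∈ mem (rat q) L → w ∈ mem (rat q) U → False := fun q h1 h2 =>
    (inf_compl_self (mem (rat q) L ⊓ mem (rat q) U)).le ⟨⟨h1, h2⟩, mem_iInf_apply hd q⟩
  have loc : ∀ q r : ℚ, q < r → w ∈ mem (rat q) L ∨ w ∈ mem (rat r) U := fun q r hqr =>
    mem_iInf_apply (mem_iInf_apply (mem_iInf_apply hl q) r) hqr
  have hLU : ∀ q r : ℚ, w ∈ mem (rat q) L → w ∈ mem (rat r) U → q ≤ r := fun q r hq hr => by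
    by_contra! hlt
    exact disj q hq ((rU q).2 ⟨r, hlt, hr⟩)
  obtain ⟨q₀, hq₀⟩ := Opens.mem_iSup.1 hL
  obtain ⟨r₀, hr₀⟩ := Opens.mem_iSup.1 hU
  set S : Set ℝ := {s | ∃ q : ℚ, w ∈ mem (rat q) L ∧ (q : ℝ) = s} with hS
  have hne : S.Nonempty := ⟨q₀, q₀, hq₀, rfl⟩
  have hub : ∀ r : ℚ, w ∈ mem (rat r) U → (r : ℝ) ∈ upperBounds S := by
    rintro r hr _ ⟨q, hq, rfl⟩
    exact_mod_cast hLU q r hq hr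
  have hbdd : BddAbove S := ⟨r₀, hub r₀ hr₀⟩
  have hle : ∀ q : ℚ, w ∈ mem (rat q) L → (q : ℝ) ≤ sSup S := fun q hq =>
    le_csSup hbdd ⟨q, hq, rfl⟩
  refine ⟨sSup S, fun q => ?_⟩
  rw [mem_lo_iff hx, mem_up_iff hx]
  refine ⟨⟨fun hq => ?_, fun hq => ?_⟩, ⟨fun hq => ?_, fun hq => ?_⟩⟩
  · obtain ⟨r, hqr, hr⟩ := (rL q).1 hq
    exact lt_of_lt_of_le (by exact_mod_cast hqr) (hle r hr)
  · obtain ⟨_, ⟨r, hr, rfl⟩, hqr⟩ := exists_lt_of_lt_csSup hne hq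
    exact (rL q).2 ⟨r, by exact_mod_cast hqr, hr⟩
  · obtain ⟨r, hrq, hr⟩ := (rU q).1 hq
    exact lt_of_le_of_lt (csSup_le hne (hub r hr)) (by exact_mod_cast hrq)
  -- Locatedness enters here: `r` lies strictly above the supremum, so it is not in the lower set
  -- and `q` must be in the upper one.
  · obtain ⟨r, hr, hrq⟩ := exists_rat_btwn hq
    refine (loc r q (by exact_mod_cast hrq)).resolve_left fun h => ?_
    exact absurd (hle r h) (not_le.2 hr)

theorem isValue_re_opair {x y : Name (Opens T)} {r : ℝ} (h : IsValue w x r) :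
    IsValue w (re (opair x y)) r := by
  rw [re, isValue_cut]
  intro q
  simp only [Opens.mem_iSup, Opens.mem_inf, mem_eq_opair]
  rw [← (h q).1, ← (h q).2]
  exact ⟨⟨fun ⟨_, _, h1, h2⟩ => (mem_lo_congr h1.1).2 h2,
      fun h => ⟨x, y, ⟨mem_eq_refl _, mem_eq_refl _⟩, h⟩⟩,
    ⟨fun ⟨_, _, h1, h2⟩ => (mem_up_congr h1.1).2 h2,
      fun h => ⟨x, y, ⟨mem_eq_refl _, mem_eq_refl _⟩, h⟩⟩⟩

theorem isValue_im_opair {x y : Name (Opens T)} {r : ℝ} (h : IsValue w y r) :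
    IsValue w (im (opair x y)) r := by
  rw [im, isValue_cut]
  intro q
  simp only [Opens.mem_iSup, Opens.mem_inf, mem_eq_opair]
  rw [← (h q).1, ← (h q).2]
  exact ⟨⟨fun ⟨_, _, h1, h2⟩ => (mem_lo_congr h1.2).2 h2,
      fun h => ⟨x, y, ⟨mem_eq_refl _, mem_eq_refl _⟩, h⟩⟩,
    ⟨fun ⟨_, _, h1, h2⟩ => (mem_up_congr h1.2).2 h2,
      fun h => ⟨x, y, ⟨mem_eq_refl _, mem_eq_refl _⟩, h⟩⟩⟩

theorem isComplexValue_opair {x y : Name (Opens T)} {c : ℂ} (hx : IsValue w x c.re)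
    (hy : IsValue w y c.im) : IsComplexValue w (opair x y) c :=
  ⟨isValue_re_opair hx, isValue_im_opair hy⟩

theorem IsComplexValue.congr {z z' : Name (Opens T)} {c : ℂ} (h : w ∈ eq z z')
    (hz : IsComplexValue w z c) : IsComplexValue w z' c := by
  simp only [IsComplexValue, re, im, isValue_cut, Opens.mem_iSup, Opens.mem_inf] at hz ⊢
  have key : ∀ u : Name (Opens T), w ∈ eq z u ↔ w ∈ eq z' u := fun u =>
    ⟨mem_eq_trans (mem_eq_symm h), mem_eq_trans h⟩
  simpa only [key] using hz

theorem IsComplexValue.unique {z : Name (Opens T)} {c d : ℂ} (hc : IsComplexValue w z c)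
    (hd : IsComplexValue w z d) : c = d :=
  Complex.ext (hc.1.unique hd.1) (hc.2.unique hd.2)

theorem exists_isComplexValue {z : Name (Opens T)} (h : w ∈ IsComplex z) :
    ∃ c, IsComplexValue w z c := by
  simp only [IsComplex, Opens.mem_iSup, Opens.mem_inf] at h
  obtain ⟨x, y, ⟨hz, hx⟩, hy⟩ := h
  obtain ⟨r, hr⟩ := exists_isValue hx
  obtain ⟨s, hs⟩ := exists_isValue hy
  exact ⟨⟨r, s⟩, (isComplexValue_opair hr hs).congr (mem_eq_symm hz)⟩

/-- Converse of `exists_isValue`, with values required at every point because the cut axioms contain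
infima and negations, which cannot be verified at one point alone. -/
theorem isReal_cut {φ ψ : ℚ → Opens T} (h : ∀ w, ∃ r, IsValue w (cut φ ψ) r) :
    IsReal (cut φ ψ) = ⊤ := by
  simp only [isValue_cut] at h
  have hc : IsCut (sepRat φ) (sepRat ψ) = ⊤ := by
    have hs : ∀ θ : ℚ → Opens T, sub (sepRat θ) ratSet = ⊤ := fun θ =>
      iInf_eq_top.2 fun x => himp_eq_top_iff.2 (by
        rw [sepRat, ratSet, sepRat, mem_mk, mem_mk]
        exact iSup_mono fun q => inf_le_inf_right _ le_top)
    simp only [IsCut, hs, mem_rat_sepRat, inf_eq_top_iff, iInf_eq_top, bihimp_eq_top, true_and]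
    refine ⟨⟨⟨⟨⟨?_, ?_⟩, ?_⟩, ?_⟩, ?_⟩, ?_⟩
    · refine eq_top_iff.2 fun w _ => ?_
      obtain ⟨r, hr⟩ := h w
      obtain ⟨q, hq⟩ := exists_rat_lt r
      exact Opens.mem_iSup.2 ⟨q, (hr q).1.2 hq⟩
    · refine eq_top_iff.2 fun w _ => ?_
      obtain ⟨r, hr⟩ := h w
      obtain ⟨q, hq⟩ := exists_rat_gt r
      exact Opens.mem_iSup.2 ⟨q, (hr q).2.2 hq⟩
    · intro q
      ext w
      obtain ⟨r, hr⟩ := h w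
      simp only [SetLike.mem_coe, Opens.mem_iSup, exists_prop, hr]
      constructor
      · intro hq
        obtain ⟨s, h1, h2⟩ := exists_rat_btwn hq
        exact ⟨s, by exact_mod_cast h1, h2⟩
      · rintro ⟨s, h1, h2⟩
        exact lt_trans (by exact_mod_cast h1) h2
    · intro q
      ext w
      obtain ⟨r, hr⟩ := h w
      simp only [SetLike.mem_coe, Opens.mem_iSup, exists_prop, hr]
      constructor
      · intro hq
        obtain ⟨s, h1, h2⟩ := exists_rat_btwn hq
        exact ⟨s, by exact_mod_cast h2, h1⟩
      · rintro ⟨s, h1, h2⟩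
        exact lt_trans h2 (by exact_mod_cast h1)
    · intro q
      rw [← himp_bot, himp_eq_top_iff]
      intro w hw
      obtain ⟨r, hr⟩ := h w
      exact absurd ((hr q).1.1 hw.1) (((hr q).2.1 hw.2).not_gt)
    · intro q s hqs
      refine eq_top_iff.2 fun w _ => ?_
      obtain ⟨r, hr⟩ := h w
      rcases lt_or_ge (q : ℝ) r with hq | hq
      · exact Or.inl ((hr q).1.2 hq)
      · exact Or.inr ((hr s).2.2 (lt_of_le_of_lt hq (by exact_mod_cast hqs)))
  refine eq_top_iff.2 (le_iSup_of_le (sepRat φ) (le_iSup_of_le (sepRat ψ) ?_))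
  rw [hc, cut, eq_refl, inf_idem]

theorem isComplex_opair {x y : Name (Opens T)} (hx : IsReal x = ⊤) (hy : IsReal y = ⊤) :
    IsComplex (opair x y) = ⊤ := by
  refine eq_top_iff.2 (le_iSup_of_le x (le_iSup_of_le y ?_))
  rw [hx, hy, eq_refl, inf_idem, inf_idem]

theorem isComplex_opair_cut {φ ψ φ' ψ' : ℚ → Opens T}
    (h : ∀ w, ∃ r, IsValue w (cut φ ψ) r) (h' : ∀ w, ∃ r, IsValue w (cut φ' ψ') r) :
    IsComplex (opair (cut φ ψ) (cut φ' ψ')) = ⊤ :=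
  isComplex_opair (isReal_cut h) (isReal_cut h')

/-! ### Arithmetic acts pointwise on values -/

theorem isValue_constR (r : ℝ) : IsValue w (constR r) r := by
  rw [constR, isValue_cut]
  simp only [Opens.mem_iSup, Opens.mem_top, exists_prop, and_true, implies_true]

theorem IsValue.negR {x : Name (Opens T)} {r : ℝ} (h : IsValue w x r) :
    IsValue w (negR x) (-r) := by
  rw [TopModel.negR, isValue_cut]
  intro q
  rw [(h (-q)).1, (h (-q)).2]
  push_cast
  exact ⟨lt_neg, neg_lt⟩

theorem IsValue.addR {x y : Name (Opens T)} {r s : ℝ} (hx : IsValue w x r)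
    (hy : IsValue w y s) : IsValue w (addR x y) (r + s) := by
  rw [TopModel.addR, isValue_cut]
  intro q
  simp only [Opens.mem_iSup, Opens.mem_inf, hx _, hy _]
  push_cast
  refine ⟨⟨?_, fun h => ?_⟩, ⟨?_, fun h => ?_⟩⟩
  · rintro ⟨t, h1, h2⟩
    linarith
  · obtain ⟨t, h1, h2⟩ := exists_rat_btwn (show (q : ℝ) - s < r by linarith)
    exact ⟨t, h2, by linarith⟩
  · rintro ⟨t, h1, h2⟩
    linarith
  · obtain ⟨t, h1, h2⟩ := exists_rat_btwn (show r < (q : ℝ) - s by linarith)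
    exact ⟨t, h1, by linarith⟩

/-- The product is affine in each variable, so moving first `s` and then `r` to a suitable end of
its interval does not increase it. -/
theorem min_mul_le {a b c d r s : ℝ} (ha : a < r) (hb : r < b) (hc : c < s) (hd : s < d) :
    min (min (a * c) (a * d)) (min (b * c) (b * d)) ≤ r * s := by
  have side : ∀ e : ℝ, min (e * c) (e * d) ≤ e * s := fun e => by
    rcases le_total 0 e with he | he
    · exact (min_le_left _ _).trans (mul_le_mul_of_nonneg_left hc.le he)
    · exact (min_le_right _ _).trans (mul_le_mul_of_nonpos_left hd.le he)
  rcases le_total 0 s with hs | hs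
  · exact ((min_le_left _ _).trans (side a)).trans (mul_le_mul_of_nonneg_right ha.le hs)
  · exact ((min_le_right _ _).trans (side b)).trans (mul_le_mul_of_nonpos_right hb.le hs)

theorem le_max_mul {a b c d r s : ℝ} (ha : a < r) (hb : r < b) (hc : c < s) (hd : s < d) :
    r * s ≤ max (max (a * c) (a * d)) (max (b * c) (b * d)) := by
  have side : ∀ e : ℝ, e * s ≤ max (e * c) (e * d) := fun e => by
    rcases le_total 0 e with he | he
    · exact (mul_le_mul_of_nonneg_left hd.le he).trans (le_max_right _ _)
    · exact (mul_le_mul_of_nonpos_left hc.le he).trans (le_max_left _ _)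
  rcases le_total 0 s with hs | hs
  · exact (mul_le_mul_of_nonneg_right hb.le hs).trans ((side b).trans (le_max_right _ _))
  · exact (mul_le_mul_of_nonpos_right ha.le hs).trans ((side a).trans (le_max_left _ _))

/-- An open set of the plane contains a closed rational rectangle around each of its points. -/
theorem exists_rat_rectangle {S : Set (ℝ × ℝ)} (hS : IsOpen S) {r s : ℝ} (h : (r, s) ∈ S) :
    ∃ a b c d : ℚ, (a : ℝ) < r ∧ r < b ∧ (c : ℝ) < s ∧ s < d ∧
      ∀ x y : ℝ, a ≤ x → x ≤ b → c ≤ y → y ≤ d → (x, y) ∈ S := by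
  obtain ⟨δ, hδ, hball⟩ := Metric.isOpen_iff.1 hS _ h
  obtain ⟨a, ha, ha'⟩ := exists_rat_btwn (show r - δ < r by linarith)
  obtain ⟨b, hb, hb'⟩ := exists_rat_btwn (show r < r + δ by linarith)
  obtain ⟨c, hc, hc'⟩ := exists_rat_btwn (show s - δ < s by linarith)
  obtain ⟨d, hd, hd'⟩ := exists_rat_btwn (show s < s + δ by linarith)
  refine ⟨a, b, c, d, ha', hb, hc', hd, fun x y h1 h2 h3 h4 => hball ?_⟩
  rw [Metric.mem_ball, Prod.dist_eq, max_lt_iff, Real.dist_eq, Real.dist_eq, abs_lt, abs_lt]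
  exact ⟨⟨by linarith, by linarith⟩, ⟨by linarith, by linarith⟩⟩

/-- The corner bounds give one direction. Conversely, continuity of multiplication supplies a closed
rational rectangle on which the strict inequality persists, in particular at its corners. -/
theorem IsValue.mulR {x y : Name (Opens T)} {r s : ℝ} (hx : IsValue w x r)
    (hy : IsValue w y s) : IsValue w (mulR x y) (r * s) := by
  rw [TopModel.mulR, isValue_cut]
  intro q
  simp only [Opens.mem_iSup, Opens.mem_inf, hx _, hy _, exists_prop]
  refine ⟨⟨?_, fun h => ?_⟩, ⟨?_, fun h => ?_⟩⟩
  · rintro ⟨a, b, c, d, hq, ⟨⟨ha, hb⟩, hc⟩, hd⟩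
    refine lt_of_lt_of_le ?_ (min_mul_le ha hb hc hd)
    exact_mod_cast hq
  · obtain ⟨a, b, c, d, ha, hb, hc, hd, H⟩ := exists_rat_rectangle
      (isOpen_lt continuous_const (continuous_fst.mul continuous_snd) :
        IsOpen {p : ℝ × ℝ | (q : ℝ) < p.1 * p.2}) h
    have hab := ha.le.trans hb.le
    have hcd := hc.le.trans hd.le
    have h1 := H a c le_rfl hab le_rfl hcd
    have h2 := H a d le_rfl hab hcd le_rfl
    have h3 := H b c hab le_rfl le_rfl hcd
    have h4 := H b d hab le_rfl hcd le_rfl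
    simp only [Set.mem_ofPred_eq] at h1 h2 h3 h4
    refine ⟨a, b, c, d, ?_, ⟨⟨ha, hb⟩, hc⟩, hd⟩
    simp only [lt_min_iff]
    exact ⟨⟨by exact_mod_cast h1, by exact_mod_cast h2⟩, by exact_mod_cast h3,
      by exact_mod_cast h4⟩
  · rintro ⟨a, b, c, d, hq, ⟨⟨ha, hb⟩, hc⟩, hd⟩
    refine lt_of_le_of_lt (le_max_mul ha hb hc hd) ?_
    exact_mod_cast hq
  · obtain ⟨a, b, c, d, ha, hb, hc, hd, H⟩ := exists_rat_rectangle
      (isOpen_lt (continuous_fst.mul continuous_snd) continuous_const :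
        IsOpen {p : ℝ × ℝ | p.1 * p.2 < (q : ℝ)}) h
    have hab := ha.le.trans hb.le
    have hcd := hc.le.trans hd.le
    have h1 := H a c le_rfl hab le_rfl hcd
    have h2 := H a d le_rfl hab hcd le_rfl
    have h3 := H b c hab le_rfl le_rfl hcd
    have h4 := H b d hab le_rfl hcd le_rfl
    simp only [Set.mem_ofPred_eq] at h1 h2 h3 h4
    refine ⟨a, b, c, d, ?_, ⟨⟨ha, hb⟩, hc⟩, hd⟩
    simp only [max_lt_iff]
    exact ⟨⟨by exact_mod_cast h1, by exact_mod_cast h2⟩, by exact_mod_cast h3,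
      by exact_mod_cast h4⟩

theorem isComplexValue_constC (c : ℂ) : IsComplexValue w (constC c) c :=
  isComplexValue_opair (isValue_constR _) (isValue_constR _)

theorem IsComplexValue.addC {x y : Name (Opens T)} {c d : ℂ} (hx : IsComplexValue w x c)
    (hy : IsComplexValue w y d) : IsComplexValue w (addC x y) (c + d) :=
  isComplexValue_opair (hx.1.addR hy.1) (hx.2.addR hy.2)

theorem IsComplexValue.negC {x : Name (Opens T)} {c : ℂ} (hx : IsComplexValue w x c) :
    IsComplexValue w (negC x) (-c) :=
  isComplexValue_opair hx.1.negR hx.2.negR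

theorem IsComplexValue.mulC {x y : Name (Opens T)} {c d : ℂ} (hx : IsComplexValue w x c)
    (hy : IsComplexValue w y d) : IsComplexValue w (mulC x y) (c * d) := by
  refine isComplexValue_opair ?_ ?_
  · rw [Complex.mul_re, sub_eq_add_neg]
    exact (hx.1.mulR hy.1).addR (hx.2.mulR hy.2).negR
  · rw [Complex.mul_im]
    exact (hx.1.mulR hy.2).addR (hx.2.mulR hy.1)

theorem IsComplexValue.powC {z : Name (Opens T)} {c : ℂ} (hz : IsComplexValue w z c) (k : ℕ) :
    IsComplexValue w (powC z k) (c ^ k) := by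
  induction k with
  | zero =>
    rw [pow_zero]
    exact isComplexValue_constC 1
  | succ k ih =>
    rw [pow_succ]
    exact ih.mulC hz

theorem IsComplexValue.sumC {a : ℕ → Name (Opens T)} {z : Name (Opens T)} {α : ℕ → ℂ} {c : ℂ}
    (hz : IsComplexValue w z c) {m : ℕ} (ha : ∀ k < m, IsComplexValue w (a k) (α k)) :
    IsComplexValue w (sumC a z m) (∑ k ∈ Finset.range m, α k * c ^ k) := by
  induction m with
  | zero => exact isComplexValue_constC 0
  | succ m ih =>
    rw [Finset.sum_range_succ]
    exact (ih fun k hk => ha k (hk.trans m.lt_succ_self)).addC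
      ((ha m m.lt_succ_self).mulC (hz.powC m))

/-! ### The polynomial `X ^ 2 - c` and its roots -/

theorem isComplex_constC (c : ℂ) : IsComplex (constC c : Name (Opens T)) = ⊤ :=
  isComplex_opair_cut (fun _ => ⟨_, isValue_constR _⟩) fun _ => ⟨_, isValue_constR _⟩

theorem isComplex_negC {x : Name (Opens T)} (hx : ∀ w, ∃ c, IsComplexValue w x c) :
    IsComplex (negC x) = ⊤ :=
  isComplex_opair_cut (fun w => (hx w).imp' _ fun _ h => h.1.negR)
    fun w => (hx w).imp' _ fun _ h => h.2.negR

/-- An implication is valid if it holds at each point. -/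
theorem himp_eq_top_of_forall {a b : Opens T} (h : ∀ w, w ∈ a → w ∈ b) : a ⇨ b = ⊤ :=
  himp_eq_top_iff.2 fun w hw => h w hw

theorem mem_opair_nat_sqSub {c x : Name (Opens T)} {k : Fin 3} :
    w ∈ mem (opair (nat k) x) (sqSub c) ↔ w ∈ eq x (![negC c, constC 0, constC 1] k) := by
  rw [sqSub, mem_mem_mk]
  simp only [Opens.mem_top, true_and, mem_eq_opair, mem_eq_nat]
  constructor
  · rintro ⟨j, hj, h⟩
    rwa [Fin.ext hj]
  · exact fun h => ⟨k, rfl, h⟩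

theorem isMonicPoly_sqSub {c : Name (Opens T)} (hc : ∀ w, ∃ d, IsComplexValue w c d) :
    IsMonicPoly 2 (sqSub c) = ⊤ := by
  have hcoeff : ∀ k : Fin 3, IsComplex (![negC c, constC 0, constC 1] k) = ⊤ := by
    intro k
    fin_cases k
    · exact isComplex_negC hc
    · exact isComplex_constC 0
    · exact isComplex_constC 1
  simp only [IsMonicPoly, IsPoly, inf_eq_top_iff, iInf_eq_top]
  refine ⟨⟨⟨fun x => ?_, fun k => ?_⟩, fun k x y => ?_⟩, ?_⟩
  · refine himp_eq_top_of_forall fun w hw => ?_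
    obtain ⟨k, -, hk⟩ := mem_mem_mk.1 hw
    simp only [Opens.mem_iSup]
    refine ⟨k, _, ?_, hk⟩
    rw [hcoeff k]
    trivial
  · refine eq_top_iff.2 fun w _ => Opens.mem_iSup.2 ⟨![negC c, constC 0, constC 1] k, ?_⟩
    exact (mem_opair_nat_sqSub (k := k)).2 (mem_eq_refl _)
  · refine himp_eq_top_of_forall fun w hw => ?_
    exact mem_eq_trans ((mem_opair_nat_sqSub (k := k)).1 hw.1)
      (mem_eq_symm ((mem_opair_nat_sqSub (k := k)).1 hw.2))
  · exact eq_top_iff.2 fun w _ => (mem_opair_nat_sqSub (k := 2)).2 (mem_eq_refl _)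

theorem sq_eq_of_mem_isRoot_sqSub {c z : Name (Opens T)} {d e : ℂ}
    (h : w ∈ IsRoot 2 (sqSub c) z) (hc : IsComplexValue w c d) (hz : IsComplexValue w z e) :
    e ^ 2 = d := by
  simp only [IsRoot, Opens.mem_iSup, Opens.mem_inf] at h
  obtain ⟨a, ha, h0⟩ := h
  -- The coefficients are fixed only up to equality at `w`, which is enough to determine their
  -- values there.
  have ha' : ∀ k : Fin 3, w ∈ eq (a k) (![negC c, constC 0, constC 1] k) := fun k =>
    mem_opair_nat_sqSub.1 (mem_iInf_apply ha k)
  have h0a : IsComplexValue w (a 0) (-d) := hc.negC.congr (mem_eq_symm (ha' 0))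
  have h1a : IsComplexValue w (a 1) 0 := (isComplexValue_constC 0).congr (mem_eq_symm (ha' 1))
  have h2a : IsComplexValue w (a 2) 1 := (isComplexValue_constC 1).congr (mem_eq_symm (ha' 2))
  have hs := hz.sumC (a := a) (m := 3) (α := fun k => if k = 0 then -d else if k = 1 then 0 else 1)
    (by
      intro k hk
      interval_cases k
      · exact h0a
      · exact h1a
      · exact h2a)
  have := (hs.congr h0).unique (isComplexValue_constC 0)
  simp [Finset.sum_range_succ] at this
  linear_combination this

/-! ### Continuity of values and the missing square root -/

/-- Within `V`, the conditions `q < f` and `f < q` cut out the open sets `lo x q` and `up x q`, and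
rational rays suffice to test continuity. -/
theorem continuousOn_of_isValue {x : Name (Opens T)} {V : Set T} {f : T → ℝ}
    (h : ∀ w ∈ V, IsValue w x (f w)) : ContinuousOn f V := by
  intro w hw
  refine tendsto_order.2 ⟨fun b hb => ?_, fun b hb => ?_⟩
  · obtain ⟨q, h1, h2⟩ := exists_rat_btwn hb
    filter_upwards [mem_nhdsWithin_of_mem_nhds ((lo x q).isOpen.mem_nhds ((h w hw q).1.2 h2)),
      self_mem_nhdsWithin] with u hu huV
    exact h1.trans ((h u huV q).1.1 hu)
  · obtain ⟨q, h1, h2⟩ := exists_rat_btwn hb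
    filter_upwards [mem_nhdsWithin_of_mem_nhds ((up x q).isOpen.mem_nhds ((h w hw q).2.2 h1)),
      self_mem_nhdsWithin] with u hu huV
    exact ((h u huV q).2.1 hu).trans h2

theorem continuousOn_of_isComplexValue {z : Name (Opens T)} {V : Set T} {f : T → ℂ}
    (h : ∀ w ∈ V, IsComplexValue w z (f w)) : ContinuousOn f V := by
  have h1 : ContinuousOn (fun w => (f w).re) V := continuousOn_of_isValue fun w hw => (h w hw).1
  have h2 : ContinuousOn (fun w => (f w).im) V := continuousOn_of_isValue fun w hw => (h w hw).2
  have : f = fun w => ((f w).re : ℂ) + (f w).im * Complex.I :=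
    funext fun w => (Complex.re_add_im _).symm
  rw [this]
  exact (Complex.continuous_ofReal.comp_continuousOn h1).add
    ((Complex.continuous_ofReal.comp_continuousOn h2).mul continuousOn_const)

end Points

/-- There is no continuous branch of the square root of `w - v` in a neighbourhood of `v`. -/
theorem not_exists_continuousOn_sq_eq_sub {V : Set ℂ} {v : ℂ} (hV : V ∈ nhds v) {f : ℂ → ℂ}
    (hf : ContinuousOn f V) (hsq : ∀ w ∈ V, f w ^ 2 = w - v) : False := by
  obtain ⟨ε, hε, hball⟩ := Metric.mem_nhds_iff.1 hV
  -- Since `ρ ≤ 1`, also `ρ ^ 2 ≤ ρ ≤ ε / 2 < ε`, which keeps the circle of radius `ρ ^ 2` around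
  -- `v` inside `V`.
  set ρ : ℝ := min 1 (ε / 2) with hρ
  have hρ0 : 0 < ρ := lt_min one_pos (half_pos hε)
  have hρ1 : ρ ^ 2 < ε := by
    have h1 : ρ ≤ 1 := min_le_left _ _
    have h2 : ρ ≤ ε / 2 := min_le_right _ _
    nlinarith
  -- As `θ` runs from `0` to `π`, the point `v + g θ ^ 2` goes once around `v`, while `g` itself
  -- only reaches `-g 0`.
  let g : ℝ → ℂ := fun θ => ρ * Complex.exp (θ * Complex.I)
  have hg : Continuous g := by fun_prop
  have hg0 : ∀ θ, g θ ≠ 0 := fun θ =>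
    mul_ne_zero (by exact_mod_cast hρ0.ne') (Complex.exp_ne_zero _)
  have hgV : ∀ θ, v + g θ ^ 2 ∈ V := fun θ => hball (by
    rw [Metric.mem_ball, dist_eq_norm, add_sub_cancel_left, norm_pow, norm_mul,
      Complex.norm_exp_ofReal_mul_I, mul_one, Complex.norm_real, Real.norm_of_nonneg hρ0.le]
    exact hρ1)
  have hgπ : g Real.pi = -g 0 := by simp [g, Complex.exp_pi_mul_I]
  have hfg : Continuous fun θ => f (v + g θ ^ 2) :=
    hf.comp_continuous (by fun_prop) hgV
  have hfπ : f (v + g Real.pi ^ 2) = f (v + g 0 ^ 2) := by rw [hgπ, neg_sq]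
  -- Two continuous square roots of the same nowhere vanishing function on the line differ by one
  -- global sign. But `f` along the loop returns to its initial value and `g` changes sign.
  have key := isPreconnected_univ.eq_or_eq_neg_of_sq_eq (f := fun θ => f (v + g θ ^ 2)) (g := g)
    hfg.continuousOn hg.continuousOn
    (fun θ _ => by simp [hsq _ (hgV θ)]) (fun {θ} _ => hg0 θ)
  have h0 : g 0 = -g 0 := by
    rcases key with h | h
    · have h1 := h (Set.mem_univ (0 : ℝ))
      have h2 := h (Set.mem_univ Real.pi)
      simp only at h1 h2
      rw [← hgπ, ← h1, ← h2, hfπ]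
    · have h1 := h (Set.mem_univ (0 : ℝ))
      have h2 := h (Set.mem_univ Real.pi)
      simp only [Pi.neg_apply] at h1 h2
      rw [← h1, ← hfπ, h2, hgπ, neg_neg]
  exact hg0 0 (self_eq_neg.1 h0)

theorem not_forces_hasRoot_sqSub {c : Name (Opens ℂ)} {v : ℂ}
    (hc : ∀ w, IsComplexValue w c (w - v)) {U : Opens ℂ} (hv : v ∈ U) :
    ¬ (U ⊩ HasRoot 2 (sqSub c)) := by
  intro h
  -- An existential is a union, so a single `z` is a root on an open neighbourhood of `v`, possibly
  -- smaller than `U`.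
  obtain ⟨z, hz⟩ := Opens.mem_iSup.1 (h hv)
  have hval : ∀ w, ∃ e, w ∈ IsComplex z ⊓ IsRoot 2 (sqSub c) z → IsComplexValue w z e := by
    intro w
    by_cases hw : w ∈ IsComplex z ⊓ IsRoot 2 (sqSub c) z
    · exact (exists_isComplexValue hw.1).imp fun _ he _ => he
    -- The value `0` off this neighbourhood only makes `f` total.
    · exact ⟨0, fun h => absurd h hw⟩
  choose f hf using hval
  exact not_exists_continuousOn_sq_eq_sub
    ((IsComplex z ⊓ IsRoot 2 (sqSub c) z).isOpen.mem_nhds hz)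
    (continuousOn_of_isComplexValue hf)
    fun w hw => sq_eq_of_mem_isRoot_sqSub hw.2 (hc w) (hf w hw)

theorem isComplexValue_generic (w : ℂ) : IsComplexValue w generic w :=
  isComplexValue_opair (isValue_cut.2 fun _ => ⟨Iff.rfl, Iff.rfl⟩)
    (isValue_cut.2 fun _ => ⟨Iff.rfl, Iff.rfl⟩)

theorem isComplex_generic : IsComplex generic = ⊤ :=
  isComplex_opair_cut (fun _ => ⟨_, isValue_cut.2 fun _ => ⟨Iff.rfl, Iff.rfl⟩⟩)
    fun _ => ⟨_, isValue_cut.2 fun _ => ⟨Iff.rfl, Iff.rfl⟩⟩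

theorem isComplexValue_generic_sub (v w : ℂ) :
    IsComplexValue w (addC generic (negC (constC v))) (w - v) := by
  rw [sub_eq_add_neg]
  exact (isComplexValue_generic w).addC (isComplexValue_constC v).negC

theorem forces_memOpen_generic (O : Opens ℂ) : O ⊩ memOpen generic O := by
  intro w hw
  obtain ⟨a, b, c, d, ha, hb, hc, hd, h⟩ := exists_rat_rectangle
    (O.isOpen.preimage Complex.equivRealProdCLM.symm.continuous) (r := w.re) (s := w.im) hw
  simp only [memOpen, Opens.mem_iSup, Opens.mem_inf]
  obtain ⟨hre, him⟩ := isComplexValue_generic w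
  exact ⟨a, b, c, d, fun u h1 h2 h3 h4 => h u.re u.im h1.le h2.le h3.le h4.le,
    ⟨⟨(hre a).1.2 ha, (hre b).2.2 hb⟩, (him c).1.2 hc⟩, (him d).2.2 hd⟩

theorem not_forces_everyPolyHasRoot {U : Opens ℂ} (hU : U ≠ ⊥) :
    ¬ (U ⊩ EveryPolyHasRoot (Opens ℂ)) := by
  intro h
  obtain ⟨v, hv⟩ := (Opens.ne_bot_iff_nonempty U).1 hU
  refine not_forces_hasRoot_sqSub (isComplexValue_generic_sub v) hv ?_
  have h2 : EveryPolyHasRoot (Opens ℂ) ≤ _ :=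
    (iInf_le _ 2).trans ((iInf_le _ one_le_two).trans
      (iInf_le _ (sqSub (addC generic (negC (constC v))))))
  rw [isMonicPoly_sqSub fun w => ⟨_, isComplexValue_generic_sub v w⟩, top_himp] at h2
  exact le_trans h h2

end TopModel

theorem theorem6 :
    -- the whole space forces that not every (monic, nonconstant) polynomial has a root
    ((⊤ : Opens ℂ) ⊩ (EveryPolyHasRoot (Opens ℂ))ᶜ) ∧
    -- no non-empty open set forces that every polynomial has a root
    (∀ U : Opens ℂ, U ≠ ⊥ → ¬ (U ⊩ EveryPolyHasRoot (Opens ℂ))) ∧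
    -- `G` is a complex number, characterized by `O ⊩ G ∈ O`
    (((⊤ : Opens ℂ) ⊩ IsComplex generic) ∧ ∀ O : Opens ℂ, O ⊩ memOpen generic O) ∧
    -- no neighbourhood of `0` forces that `X ^ 2 - G` has a root
    (((⊤ : Opens ℂ) ⊩ IsMonicPoly 2 (sqSub generic)) ∧
      ∀ U : Opens ℂ, (0 : ℂ) ∈ U → ¬ (U ⊩ HasRoot 2 (sqSub generic))) ∧
    -- no neighbourhood of `v` forces that `X ^ 2 - (G - v)` has a root
    (∀ v : ℂ, ((⊤ : Opens ℂ) ⊩ IsMonicPoly 2 (sqSub (addC generic (negC (constC v))))) ∧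
      ∀ U : Opens ℂ, v ∈ U →
        ¬ (U ⊩ HasRoot 2 (sqSub (addC generic (negC (constC v)))))) := by
  refine ⟨?_, fun U hU => not_forces_everyPolyHasRoot hU,
    ⟨isComplex_generic.ge, forces_memOpen_generic⟩,
    ⟨(isMonicPoly_sqSub fun w => ⟨w, isComplexValue_generic w⟩).ge, fun U hU => ?_⟩,
    fun v => ⟨(isMonicPoly_sqSub fun w => ⟨_, isComplexValue_generic_sub v w⟩).ge,
      fun U hU => not_forces_hasRoot_sqSub (isComplexValue_generic_sub v) hU⟩⟩
  · by_contra h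
    -- The truth value is itself an open set forcing the statement, so it must be empty.
    refine not_forces_everyPolyHasRoot (U := EveryPolyHasRoot (Opens ℂ)) (fun hb => h ?_) le_rfl
    rw [hb, compl_bot]
    exact le_rfl
  · refine not_forces_hasRoot_sqSub (v := 0) (fun w => ?_) hU
    rw [sub_zero]
    exact isComplexValue_generic w
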